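/- For a noncommutative Lie algebra $\mathcal L$ over a field with center $Z(\mathcal L)$, let the commuting graph $\Gamma(\mathcal L)$ be the simple undirected graph with vertex set $\mathcal L\setminus Z(\mathcal L)$ in which two distinct vertices $x,y$ are adjacent if and only if $[x,y]=0$. Let $\mathfrak n_{2,1}$ be the 2-dimensional real Lie algebra with basis $e_1,e_2$ and bracket $[e_1,e_2]=e_1$. Let $\mathfrak s_{4,11}$ be the 4-dimensional real Lie algebra with basis $e_1,e_2,e_3,e_4$ and nonzero brackets (up to antisymmetry) $[e_2,e_3]=e_1$, $[e_4,e_1]=e_1$, $[e_4,e_2]=e_2$. Theorem. Let $\mathcal L$ be a noncommutative solvable Lie algebra of dimension $4$ over $\mathbb R$. Then $\Gamma(\mathcal L)$ is connected if and only if $\mathcal L$ is isomorphic, as a real Lie algebra, to $\mathfrak n_{2,1}\oplus\mathfrak n_{2,1}$ or to $\mathfrak s_{4,11}$. Moreover, $$\operatorname{diam}\Gamma(\mathfrak n_{2,1}\oplus\mathfrak n_{2,1})=\operatorname{diam}\Gamma(\mathfrak s_{4,11})=3,$$ where the diameter of a connected graph is the supremum of the distances between its vertices. -/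

import Mathlib

/-- The commuting graph of a Lie algebra `L` over `K`: the vertices are the elements of `L` that do
not lie in the center, and two distinct vertices are adjacent when their bracket vanishes. -/
def lieCommutingGraph (K L : Type*) [Field K] [LieRing L] [LieAlgebra K L] :
    SimpleGraph {x : L // x ∉ LieAlgebra.center K L} where
  Adj x y := x ≠ y ∧ ⁅(x : L), (y : L)⁆ = 0
  symm := ⟨fun x y h => ⟨h.1.symm, by rw [← lie_skew, h.2, neg_zero]⟩⟩
  loopless := ⟨fun _ h => h.1 rfl⟩

/-- The underlying vector space of the Lie algebra `𝔫₂,₁ = ⟨e₁, e₂⟩ : [e₁, e₂] = e₁` over `K`.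
The coordinate with index `i : Fin 2` is the coefficient of `e_{i+1}`. -/
def LieN21 (K : Type*) : Type _ := Fin 2 → K

namespace LieN21

variable {K : Type*} [Field K]

instance : AddCommGroup (LieN21 K) := inferInstanceAs (AddCommGroup (Fin 2 → K))

instance : Module K (LieN21 K) := inferInstanceAs (Module K (Fin 2 → K))

/-- The bilinear extension of `[e₁, e₂] = e₁ = -[e₂, e₁]`, `[e₁, e₁] = [e₂, e₂] = 0`. -/
instance : Bracket (LieN21 K) (LieN21 K) where
  bracket x y := (![x 0 * y 1 - x 1 * y 0, 0] : Fin 2 → K)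

theorem lie_apply_zero (x y : LieN21 K) : ⁅x, y⁆ 0 = x 0 * y 1 - x 1 * y 0 := rfl

theorem lie_apply_one (x y : LieN21 K) : ⁅x, y⁆ 1 = 0 := rfl

theorem add_apply (x y : LieN21 K) (i : Fin 2) : (x + y) i = x i + y i := rfl

theorem smul_apply (c : K) (x : LieN21 K) (i : Fin 2) : (c • x) i = c * x i := rfl

theorem zero_apply (i : Fin 2) : (0 : LieN21 K) i = 0 := rfl

instance : LieRing (LieN21 K) where
  add_lie x y z := by
    funext i; fin_cases i <;> simp [lie_apply_zero, lie_apply_one, add_apply] <;> ring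
  lie_add x y z := by
    funext i; fin_cases i <;> simp [lie_apply_zero, lie_apply_one, add_apply] <;> ring
  lie_self x := by
    funext i; fin_cases i <;> simp [lie_apply_zero, lie_apply_one, zero_apply] <;> ring
  leibniz_lie x y z := by
    funext i; fin_cases i <;> simp [lie_apply_zero, lie_apply_one, add_apply] <;> ring

instance : LieAlgebra K (LieN21 K) where
  lie_smul c x y := by
    funext i; fin_cases i <;> simp [lie_apply_zero, lie_apply_one, smul_apply] <;> ring

end LieN21

/-- The underlying vector space of the Lie algebra
`𝔰₄,₁₁ = ⟨e₁, e₂, e₃, e₄⟩ : [e₂, e₃] = e₁, [e₄, e₁] = e₁, [e₄, e₂] = e₂` over `K`.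
The coordinate with index `i : Fin 4` is the coefficient of `e_{i+1}`. -/
def LieS411 (K : Type*) : Type _ := Fin 4 → K

namespace LieS411

variable {K : Type*} [Field K]

instance : AddCommGroup (LieS411 K) := inferInstanceAs (AddCommGroup (Fin 4 → K))

instance : Module K (LieS411 K) := inferInstanceAs (Module K (Fin 4 → K))

/-- The alternating bilinear extension of `[e₂, e₃] = e₁`, `[e₄, e₁] = e₁`, `[e₄, e₂] = e₂`, with
`[e₁, e₂] = [e₁, e₃] = [e₃, e₄] = 0`. -/
instance : Bracket (LieS411 K) (LieS411 K) where
  bracket x y :=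
    (![(x 1 * y 2 - x 2 * y 1) + (x 3 * y 0 - x 0 * y 3), x 3 * y 1 - x 1 * y 3, 0, 0] :
      Fin 4 → K)

theorem lie_apply_zero (x y : LieS411 K) :
    ⁅x, y⁆ 0 = (x 1 * y 2 - x 2 * y 1) + (x 3 * y 0 - x 0 * y 3) := rfl

theorem lie_apply_one (x y : LieS411 K) : ⁅x, y⁆ 1 = x 3 * y 1 - x 1 * y 3 := rfl

theorem lie_apply_two (x y : LieS411 K) : ⁅x, y⁆ 2 = 0 := rfl

theorem lie_apply_three (x y : LieS411 K) : ⁅x, y⁆ 3 = 0 := rfl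

theorem add_apply (x y : LieS411 K) (i : Fin 4) : (x + y) i = x i + y i := rfl

theorem smul_apply (c : K) (x : LieS411 K) (i : Fin 4) : (c • x) i = c * x i := rfl

theorem zero_apply (i : Fin 4) : (0 : LieS411 K) i = 0 := rfl

instance : LieRing (LieS411 K) where
  add_lie x y z := by
    funext i; fin_cases i <;> simp [lie_apply_zero, lie_apply_one, lie_apply_two, lie_apply_three, add_apply] <;> ring
  lie_add x y z := by
    funext i; fin_cases i <;> simp [lie_apply_zero, lie_apply_one, lie_apply_two, lie_apply_three, add_apply] <;> ring
  lie_self x := by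
    funext i; fin_cases i <;> simp [lie_apply_zero, lie_apply_one, lie_apply_two, lie_apply_three, zero_apply] <;> ring
  leibniz_lie x y z := by
    funext i; fin_cases i <;> simp [lie_apply_zero, lie_apply_one, lie_apply_two, lie_apply_three, add_apply] <;> ring

instance : LieAlgebra K (LieS411 K) where
  lie_smul c x y := by
    funext i; fin_cases i <;> simp [lie_apply_zero, lie_apply_one, lie_apply_two, lie_apply_three, smul_apply] <;> ring

end LieS411

/-! ### Commuting graphs: diameter three, and consequences of connectedness -/

section CommutingGraph

variable {K L M : Type*} [Field K] [LieRing L] [LieAlgebra K L] [LieRing M] [LieAlgebra K M]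

/-! Connectedness forbids commuting from being transitive on noncentral elements, so some noncentral
`x` commutes with `y`, `z` while `[y, z] ≠ 0` (`exists_lie_ne_zero_of_connected`). With any `w` not
commuting with `x`, the elements `w, x, y, z` form a basis, and `[y, z]` lies in the centralizer
`⟨x, y, z⟩` of `x`.

If `[y, z] ∉ Kx`, this centralizer contains a pair with `[h, v] = v`, and the Jacobi identities
leave only the two algebras (`nonempty_lieEquiv_of_affine`). If `[y, z] ∈ Kx`, the centralizer is a
Heisenberg algebra; connectedness, used again, makes `w` commute with something outside `Kw`, which
forces `𝔰₄,₁₁` (`nonempty_lieEquiv_of_heisenberg`).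

Conversely, both algebras are centerless with graphs of diameter three; finite diameter gives
connectedness. -/

theorem LieAlgebra.mem_center_iff_forall_lie {x : L} :
    x ∈ LieAlgebra.center K L ↔ ∀ y : L, ⁅x, y⁆ = 0 := by
  rw [LieModule.mem_maxTrivSubmodule]
  exact forall_congr' fun y => by rw [← lie_skew, neg_eq_zero]

theorem LieAlgebra.notMem_center_of_lie_ne_zero {x y : L} (h : ⁅x, y⁆ ≠ 0) :
    x ∉ LieAlgebra.center K L :=
  fun hx => h (LieAlgebra.mem_center_iff_forall_lie.1 hx y)

/-- An isomorphism of Lie algebras induces an isomorphism of commuting graphs. -/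
def lieCommutingGraphIso (e : L ≃ₗ⁅K⁆ M) : lieCommutingGraph K L ≃g lieCommutingGraph K M where
  toEquiv := e.toLinearEquiv.toEquiv.subtypeEquiv fun x => not_congr <| by
    change _ ↔ e x ∈ LieAlgebra.center K M
    rw [LieAlgebra.mem_center_iff_forall_lie, LieAlgebra.mem_center_iff_forall_lie]
    refine ⟨fun h y => ?_, fun h y => e.injective ?_⟩
    · have : e ⁅x, e.symm y⁆ = 0 := by rw [h, map_zero]
      rwa [LieEquiv.map_lie, LieEquiv.apply_symm_apply] at this
    · change e ⁅x, y⁆ = e 0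
      rw [LieEquiv.map_lie, map_zero]
      exact h (e y)
  map_rel_iff' {x y} := by
    refine and_congr ((Equiv.injective _).ne_iff) ?_
    change ⁅e x, e y⁆ = 0 ↔ _
    rw [← LieEquiv.map_lie, map_eq_zero_iff e e.injective]

theorem lieCommutingGraph_edist_le_one {x y : {x : L // x ∉ LieAlgebra.center K L}}
    (h : ⁅(x : L), (y : L)⁆ = 0) : (lieCommutingGraph K L).edist x y ≤ 1 := by
  by_cases hxy : x = y
  · simp [hxy]
  · exact (SimpleGraph.Walk.cons (show (lieCommutingGraph K L).Adj x y from ⟨hxy, h⟩)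
      SimpleGraph.Walk.nil).edist_le

/-- A criterion for the commuting graph of a Lie algebra without center to have diameter three. -/
theorem lieCommutingGraph_ediam_eq_three (hZ : ∀ x : L, (∀ y : L, ⁅x, y⁆ = 0) → x = 0)
    (hle : ∀ x y : L, x ≠ 0 → y ≠ 0 →
      ∃ a b : L, a ≠ 0 ∧ b ≠ 0 ∧ ⁅x, a⁆ = 0 ∧ ⁅a, b⁆ = 0 ∧ ⁅b, y⁆ = 0)
    {u v : L} (hu : u ≠ 0) (hv : v ≠ 0) (huv : ∀ c : L, ⁅u, c⁆ = 0 → ⁅c, v⁆ = 0 → c = 0) :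
    (lieCommutingGraph K L).ediam = 3 := by
  have hmem (x : L) : x ∉ LieAlgebra.center K L ↔ x ≠ 0 := not_congr
    ⟨fun hx => hZ x (LieAlgebra.mem_center_iff_forall_lie.1 hx), fun hx => hx ▸ zero_mem _⟩
  refine le_antisymm (SimpleGraph.ediam_le_of_edist_le fun x y => ?_) ?_
  · obtain ⟨a, b, ha, hb, hxa, hab, hby⟩ := hle x y ((hmem _).1 x.2) ((hmem _).1 y.2)
    rw [← hmem] at ha hb
    calc _ ≤ (lieCommutingGraph K L).edist x ⟨a, ha⟩ + ((lieCommutingGraph K L).edist ⟨a, ha⟩ ⟨b, hb⟩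
            + (lieCommutingGraph K L).edist ⟨b, hb⟩ y) :=
          SimpleGraph.edist_triangle.trans (by gcongr; exact SimpleGraph.edist_triangle)
      _ ≤ 1 + (1 + 1) := by
          gcongr <;> exact lieCommutingGraph_edist_le_one (by assumption)
      _ = 3 := by norm_num
  · refine le_trans ?_ (SimpleGraph.edist_le_ediam (u := ⟨u, (hmem u).2 hu⟩)
      (v := ⟨v, (hmem v).2 hv⟩))
    by_contra! hlt
    obtain ⟨p, hp⟩ := SimpleGraph.exists_walk_of_edist_ne_top hlt.ne_top
    rw [← hp] at hlt
    have hlt : p.length < 3 := by exact_mod_cast hlt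
    -- On a walk of length at most two, some vertex (`u` itself if the length is at most one)
    -- commutes with both ends.
    match p, hlt with
    | .nil, _ => exact hu (huv u (lie_self u) (lie_self u))
    | .cons h .nil, _ => exact hu (huv u (lie_self u) h.2)
    | .cons (v := c) h (.cons h' .nil), _ => exact (hmem _).1 c.2 (huv c h.2 h'.2)
    | .cons h (.cons h' (.cons h'' p)), hlt =>
      simp only [SimpleGraph.Walk.length_cons] at hlt
      omega

theorem SimpleGraph.Connected.forall_of_adj_closed {V : Type*} {G : SimpleGraph V}
    (hG : G.Connected) {S : V → Prop} (hS : ∀ u v, S u → G.Adj u v → S v) {u : V} (hu : S u)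
    (v : V) : S v := by
  obtain ⟨p⟩ := hG u v
  induction p with
  | nil => exact hu
  | cons h _ ih => exact ih (hS _ _ hu h)

/-- Otherwise commuting is transitive on vertices, so the component of a vertex `u` lies in its
centralizer and `u` is central. -/
theorem exists_lie_ne_zero_of_connected (hG : (lieCommutingGraph K L).Connected) :
    ∃ x y z : L, x ∉ LieAlgebra.center K L ∧ ⁅x, y⁆ = 0 ∧ ⁅x, z⁆ = 0 ∧ ⁅y, z⁆ ≠ 0 := by
  by_contra! hcon
  obtain ⟨u⟩ := hG.nonempty
  refine u.2 (LieAlgebra.mem_center_iff_forall_lie.2 fun y => ?_)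
  by_cases hy : y ∈ LieAlgebra.center K L
  · rw [← lie_skew, LieAlgebra.mem_center_iff_forall_lie.1 hy, neg_zero]
  · exact hG.forall_of_adj_closed (S := fun v => ⁅(u : L), (v : L)⁆ = 0)
      (fun v w hv hvw => hcon v u w v.2 (by rw [← lie_skew, hv, neg_zero]) hvw.2)
      (lie_self _) ⟨y, hy⟩

/-- If the centralizer of `w` were the line `Kw`, the component of `w` would stay in that line. -/
theorem exists_lie_eq_zero_notMem_span_of_connected (hG : (lieCommutingGraph K L).Connected)
    {w : L} (hw : w ∉ LieAlgebra.center K L) : ∃ c : L, ⁅w, c⁆ = 0 ∧ ∀ t : K, c ≠ t • w := by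
  by_contra! hcon
  refine hw (LieAlgebra.mem_center_iff_forall_lie.2 fun y => ?_)
  by_cases hy : y ∈ LieAlgebra.center K L
  · rw [← lie_skew, LieAlgebra.mem_center_iff_forall_lie.1 hy, neg_zero]
  · obtain ⟨t, ht⟩ := hG.forall_of_adj_closed (S := fun v => ∃ t : K, (v : L) = t • w)
      (fun v z ⟨t, ht⟩ hvz => hcon z (by
        have h := hvz.2
        rw [ht, smul_lie] at h
        refine (smul_eq_zero.1 h).resolve_left fun h0 => v.2 ?_
        rw [ht, h0, zero_smul]
        exact zero_mem _))
      (u := ⟨w, hw⟩) ⟨1, (one_smul K w).symm⟩ ⟨y, hy⟩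
    rw [show y = t • w from ht, lie_smul, lie_self, smul_zero]

end CommutingGraph

/-! ### The two algebras have commuting graphs of diameter three -/

section Examples

variable {K : Type*}

namespace LieN21

/-- The element `a e₁ + b e₂` of `𝔫₂,₁`. -/
def mk (a b : K) : LieN21 K := (![a, b] : Fin 2 → K)

@[simp] theorem mk_apply_zero (a b : K) : mk a b 0 = a := rfl

@[simp] theorem mk_apply_one (a b : K) : mk a b 1 = b := rfl

variable [Field K]

theorem lie_eq_zero_iff {x y : LieN21 K} : ⁅x, y⁆ = 0 ↔ x 0 * y 1 - x 1 * y 0 = 0 := by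
  refine ⟨fun h => congrFun h 0, fun h => funext fun i => ?_⟩
  fin_cases i
  exacts [h, rfl]

theorem eq_zero_iff {x : LieN21 K} : x = 0 ↔ x 0 = 0 ∧ x 1 = 0 := by
  refine ⟨fun h => ⟨congrFun h 0, congrFun h 1⟩, fun h => funext fun i => ?_⟩
  fin_cases i
  exacts [h.1, h.2]

theorem prod_lie_eq_zero_iff {x y : LieN21 K × LieN21 K} :
    ⁅x, y⁆ = 0 ↔ ⁅x.1, y.1⁆ = 0 ∧ ⁅x.2, y.2⁆ = 0 :=
  Prod.mk_eq_zero

theorem eq_zero_of_forall_lie {x : LieN21 K} (h : ∀ y : LieN21 K, ⁅x, y⁆ = 0) : x = 0 := by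
  have h1 := lie_eq_zero_iff.1 (h (mk 1 0))
  have h2 := lie_eq_zero_iff.1 (h (mk 0 1))
  rw [eq_zero_iff]
  simp_all

theorem ediam_lieCommutingGraph_prod :
    (lieCommutingGraph K (LieN21 K × LieN21 K)).ediam = 3 := by
  have hne : mk (1 : K) 0 ≠ 0 := fun h => one_ne_zero (congrFun h 0)
  have hne' : mk (0 : K) 1 ≠ 0 := fun h => one_ne_zero (congrFun h 1)
  -- In `𝔫₂,₁` the centralizers of `e₁` and `e₂` are the lines they span, so they meet in zero. For
  -- the upper bound, elements of different summands commute: the generic path is `(p, q)`, `(p,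
  -- 0)`, `(0, q')`, `(p', q')`.
  refine lieCommutingGraph_ediam_eq_three (u := (mk 1 0, mk 1 0)) (v := (mk 0 1, mk 0 1))
    (fun x hx => ?_) ?_ (by simp [hne]) (by simp [hne']) ?_
  · exact Prod.ext (eq_zero_of_forall_lie fun y => (prod_lie_eq_zero_iff.1 (hx (y, 0))).1)
      (eq_zero_of_forall_lie fun y => (prod_lie_eq_zero_iff.1 (hx (0, y))).2)
  · rintro ⟨p, q⟩ ⟨p', q'⟩ hx hy
    simp only [prod_lie_eq_zero_iff]
    by_cases hp : p = 0
    · by_cases hp' : p' = 0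
      · exact ⟨(mk 1 0, 0), (mk 1 0, 0), by simp [hne], by simp [hne], by simp [hp], by simp,
          by simp [hp']⟩
      · have hq : q ≠ 0 := fun hq => hx (by rw [hp, hq]; rfl)
        exact ⟨(0, q), (p', 0), by simp [hq], by simp [hp'], by simp, by simp, by simp⟩
    · by_cases hq' : q' = 0
      · by_cases hq : q = 0
        · exact ⟨(0, mk 1 0), (0, mk 1 0), by simp [hne], by simp [hne], by simp [hq], by simp,
            by simp [hq']⟩
        · have hp' : p' ≠ 0 := fun hp' => hy (by rw [hp', hq']; rfl)
          exact ⟨(0, q), (p', 0), by simp [hq], by simp [hp'], by simp, by simp, by simp⟩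
      · exact ⟨(p, 0), (0, q'), by simp [hp], by simp [hq'], by simp, by simp, by simp⟩
  · rintro ⟨c, d⟩ h1 h2
    rw [prod_lie_eq_zero_iff, lie_eq_zero_iff, lie_eq_zero_iff] at h1 h2
    refine Prod.ext (eq_zero_iff.2 ?_) (eq_zero_iff.2 ?_) <;> simp_all

end LieN21

namespace LieS411

/-- The element `a e₁ + b e₂ + c e₃ + d e₄` of `𝔰₄,₁₁`. -/
def mk (a b c d : K) : LieS411 K := (![a, b, c, d] : Fin 4 → K)

@[simp] theorem mk_apply_zero (a b c d : K) : mk a b c d 0 = a := rfl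

@[simp] theorem mk_apply_one (a b c d : K) : mk a b c d 1 = b := rfl

@[simp] theorem mk_apply_two (a b c d : K) : mk a b c d 2 = c := rfl

@[simp] theorem mk_apply_three (a b c d : K) : mk a b c d 3 = d := rfl

variable [Field K]

theorem lie_eq_zero_iff {x y : LieS411 K} : ⁅x, y⁆ = 0 ↔
    (x 1 * y 2 - x 2 * y 1) + (x 3 * y 0 - x 0 * y 3) = 0 ∧ x 3 * y 1 - x 1 * y 3 = 0 := by
  refine ⟨fun h => ⟨congrFun h 0, congrFun h 1⟩, fun h => funext fun i => ?_⟩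
  fin_cases i
  exacts [h.1, h.2, rfl, rfl]

theorem eq_zero_iff {x : LieS411 K} : x = 0 ↔ x 0 = 0 ∧ x 1 = 0 ∧ x 2 = 0 ∧ x 3 = 0 := by
  refine ⟨fun h => ⟨congrFun h 0, congrFun h 1, congrFun h 2, congrFun h 3⟩,
    fun h => funext fun i => ?_⟩
  fin_cases i
  exacts [h.1, h.2.1, h.2.2.1, h.2.2.2]

theorem eq_zero_of_forall_lie {x : LieS411 K} (h : ∀ y : LieS411 K, ⁅x, y⁆ = 0) : x = 0 := by
  have h1 := lie_eq_zero_iff.1 (h (mk 1 0 0 0))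
  have h2 := lie_eq_zero_iff.1 (h (mk 0 1 0 0))
  have h4 := lie_eq_zero_iff.1 (h (mk 0 0 0 1))
  rw [eq_zero_iff]
  simp_all

/-- Every element commutes with a nonzero element of the abelian subalgebra `⟨e₁, e₃⟩`. -/
theorem exists_ne_zero_lie_eq_zero (x : LieS411 K) :
    ∃ a : LieS411 K, a ≠ 0 ∧ a 1 = 0 ∧ a 3 = 0 ∧ ⁅x, a⁆ = 0 := by
  -- `ad x` maps the plane `⟨e₁, e₃⟩` into the line `⟨e₁⟩`, hence has a kernel there.
  by_cases hx : x 3 = 0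
  · refine ⟨mk 1 0 0 0, fun h => one_ne_zero (congrFun h 0), rfl, rfl, ?_⟩
    simp [lie_eq_zero_iff, hx]
  · refine ⟨mk (-x 1) 0 (x 3) 0, fun h => hx (congrFun h 2), rfl, rfl, ?_⟩
    simp [lie_eq_zero_iff]
    ring

theorem ediam_lieCommutingGraph : (lieCommutingGraph K (LieS411 K)).ediam = 3 := by
  -- The centralizer of `e₄` is `⟨e₃, e₄⟩`, on which bracketing with `e₂ + e₄` is injective.
  refine lieCommutingGraph_ediam_eq_three (u := mk 0 0 0 1) (v := mk 0 1 0 1)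
    (fun _ => eq_zero_of_forall_lie) (fun x y _ _ => ?_) (fun h => one_ne_zero (congrFun h 3))
    (fun h => one_ne_zero (congrFun h 3)) (fun c h1 h2 => ?_)
  · obtain ⟨a, ha, ha1, ha3, hxa⟩ := exists_ne_zero_lie_eq_zero x
    obtain ⟨b, hb, hb1, hb3, hyb⟩ := exists_ne_zero_lie_eq_zero y
    exact ⟨a, b, ha, hb, hxa, by simp [lie_eq_zero_iff, *], by rw [← lie_skew, hyb, neg_zero]⟩
  · rw [lie_eq_zero_iff] at h1 h2
    rw [eq_zero_iff]
    simp_all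

end LieS411

end Examples

/-! ### Structure of four-dimensional algebras with connected commuting graph -/

section Classification

variable {K L : Type*} [Field K] [LieRing L] [LieAlgebra K L]

/-- Bracketing a relation with `x`, `q`, `p` in turn isolates the coefficients of `w`, `p`, `q`. -/
theorem linearIndependent_of_commuting_triple {x p q w : L} (hxp : ⁅x, p⁆ = 0) (hxq : ⁅x, q⁆ = 0)
    (hpq : ⁅p, q⁆ ≠ 0) (hwx : ⁅w, x⁆ ≠ 0) {a b c d : K}
    (h : a • w + b • x + c • p + d • q = 0) : a = 0 ∧ b = 0 ∧ c = 0 ∧ d = 0 := by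
  have hx : x ≠ 0 := fun hx => hwx (by rw [hx, lie_zero])
  have hpx : ⁅p, x⁆ = 0 := by rw [← lie_skew, hxp, neg_zero]
  have hqx : ⁅q, x⁆ = 0 := by rw [← lie_skew, hxq, neg_zero]
  have h1 : ⁅a • w + b • x + c • p + d • q, x⁆ = 0 := by rw [h, zero_lie]
  have ha : a = 0 := by simpa [hpx, hqx, hwx] using h1
  have h2 : ⁅a • w + b • x + c • p + d • q, q⁆ = 0 := by rw [h, zero_lie]
  have hc : c = 0 := by simpa [hxq, hpq, ha] using h2
  have h3 : ⁅p, a • w + b • x + c • p + d • q⁆ = 0 := by rw [h, lie_zero]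
  have hd : d = 0 := by simpa [hpx, hpq, ha] using h3
  exact ⟨ha, by simpa [ha, hc, hd, hx] using h, hc, hd⟩

theorem exists_coeffs_of_finrank_eq_four (hL : Module.finrank K L = 4) {w x p q : L}
    (hind : ∀ a b c d : K, a • w + b • x + c • p + d • q = 0 → a = 0 ∧ b = 0 ∧ c = 0 ∧ d = 0)
    (y : L) : ∃ a b c d : K, y = a • w + b • x + c • p + d • q := by
  have hli : LinearIndependent K ![w, x, p, q] := by
    rw [Fintype.linearIndependent_iff]
    intro g hg
    obtain ⟨h0, h1, h2, h3⟩ := hind (g 0) (g 1) (g 2) (g 3) (by simpa [Fin.sum_univ_four] using hg)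
    intro i
    fin_cases i <;> assumption
  have hy : y ∈ Submodule.span K (Set.range ![w, x, p, q]) := by
    rw [hli.span_eq_top_of_card_eq_finrank (by simp [hL])]
    trivial
  obtain ⟨c, hc⟩ := (Submodule.mem_span_range_iff_exists_fun K).1 hy
  exact ⟨c 0, c 1, c 2, c 3, by simpa [Fin.sum_univ_four] using hc.symm⟩

theorem nonempty_lieEquiv_of_lieHom_injective {M : Type*} [LieRing M] [LieAlgebra K M]
    [FiniteDimensional K L] [FiniteDimensional K M] (h : Module.finrank K M = Module.finrank K L)
    (f : M →ₗ⁅K⁆ L) (hf : ∀ m, f m = 0 → m = 0) : Nonempty (L ≃ₗ⁅K⁆ M) := by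
  have hinj : Function.Injective f := (injective_iff_map_eq_zero f).2 hf
  exact ⟨(LieEquiv.ofBijective f ⟨hinj,
    (LinearMap.injective_iff_surjective_of_finrank_eq_finrank (f := f.toLinearMap) h).1
      hinj⟩).symm⟩

/-- Independence need not be assumed: the brackets and `e₁ ≠ 0` already detect every coefficient. -/
theorem nonempty_lieEquiv_lieS411 (hL : Module.finrank K L = 4) {e₁ e₂ e₃ e₄ : L} (he : e₁ ≠ 0)
    (h12 : ⁅e₁, e₂⁆ = 0) (h13 : ⁅e₁, e₃⁆ = 0) (h41 : ⁅e₄, e₁⁆ = e₁)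
    (h23 : ⁅e₂, e₃⁆ = e₁) (h42 : ⁅e₄, e₂⁆ = e₂) (h43 : ⁅e₄, e₃⁆ = 0) :
    Nonempty (L ≃ₗ⁅K⁆ LieS411 K) := by
  have : FiniteDimensional K L := FiniteDimensional.of_finrank_pos (by omega)
  have : FiniteDimensional K (LieS411 K) := inferInstanceAs (FiniteDimensional K (Fin 4 → K))
  have h21 : ⁅e₂, e₁⁆ = 0 := by rw [← lie_skew, h12, neg_zero]
  have h31 : ⁅e₃, e₁⁆ = 0 := by rw [← lie_skew, h13, neg_zero]
  have h14 : ⁅e₁, e₄⁆ = -e₁ := by rw [← lie_skew, h41]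
  have h32 : ⁅e₃, e₂⁆ = -e₁ := by rw [← lie_skew, h23]
  have h24 : ⁅e₂, e₄⁆ = -e₂ := by rw [← lie_skew, h42]
  have h34 : ⁅e₃, e₄⁆ = 0 := by rw [← lie_skew, h43, neg_zero]
  let f : LieS411 K →ₗ⁅K⁆ L :=
    { toFun := fun x => x 0 • e₁ + x 1 • e₂ + x 2 • e₃ + x 3 • e₄
      map_add' := fun x y => by simp only [LieS411.add_apply]; module
      map_smul' := fun c x => by simp only [LieS411.smul_apply, RingHom.id_apply]; module
      map_lie' := fun {x y} => by
        simp only [LieS411.lie_apply_zero, LieS411.lie_apply_one, LieS411.lie_apply_two,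
          LieS411.lie_apply_three, add_lie, lie_add, smul_lie, lie_smul, lie_self, h12, h13, h41,
          h23, h42, h43, h21, h31, h14, h32, h24, h34]
        module }
  refine nonempty_lieEquiv_of_lieHom_injective (hL.symm ▸ Module.finrank_fin_fun K) f fun m hm => ?_
  replace hm : m 0 • e₁ + m 1 • e₂ + m 2 • e₃ + m 3 • e₄ = 0 := hm
  have k1 := congrArg (⁅·, e₁⁆) hm
  have k2 := congrArg (⁅e₂, ·⁆) hm
  have k3 := congrArg (⁅·, e₃⁆) hm
  have m3 : m 3 = 0 := by simpa [h21, h31, h41, he] using k1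
  have m2 : m 2 = 0 := by simpa [h21, h23, m3, he] using k2
  have m1 : m 1 = 0 := by simpa [h13, h23, m3, he] using k3
  exact LieS411.eq_zero_iff.2 ⟨by simpa [m1, m2, m3, he] using hm, m1, m2, m3⟩

theorem nonempty_lieEquiv_lieN21_prod (hL : Module.finrank K L = 4) {e₁ e₂ f₁ f₂ : L}
    (he : e₁ ≠ 0) (hf : f₁ ≠ 0) (h12 : ⁅e₁, e₂⁆ = e₁) (h34 : ⁅f₁, f₂⁆ = f₁)
    (h13 : ⁅e₁, f₁⁆ = 0) (h14 : ⁅e₁, f₂⁆ = 0) (h23 : ⁅e₂, f₁⁆ = 0) (h24 : ⁅e₂, f₂⁆ = 0) :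
    Nonempty (L ≃ₗ⁅K⁆ LieN21 K × LieN21 K) := by
  have : FiniteDimensional K L := FiniteDimensional.of_finrank_pos (by omega)
  have : FiniteDimensional K (LieN21 K) := inferInstanceAs (FiniteDimensional K (Fin 2 → K))
  have hN : Module.finrank K (LieN21 K) = 2 := Module.finrank_fin_fun K
  have h21 : ⁅e₂, e₁⁆ = -e₁ := by rw [← lie_skew, h12]
  have h43 : ⁅f₂, f₁⁆ = -f₁ := by rw [← lie_skew, h34]
  have h31 : ⁅f₁, e₁⁆ = 0 := by rw [← lie_skew, h13, neg_zero]
  have h41 : ⁅f₂, e₁⁆ = 0 := by rw [← lie_skew, h14, neg_zero]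
  have h32 : ⁅f₁, e₂⁆ = 0 := by rw [← lie_skew, h23, neg_zero]
  have h42 : ⁅f₂, e₂⁆ = 0 := by rw [← lie_skew, h24, neg_zero]
  let f : LieN21 K × LieN21 K →ₗ⁅K⁆ L :=
    { toFun := fun x => x.1 0 • e₁ + x.1 1 • e₂ + x.2 0 • f₁ + x.2 1 • f₂
      map_add' := fun x y => by
        simp only [Prod.fst_add, Prod.snd_add, LieN21.add_apply]; module
      map_smul' := fun c x => by
        simp only [Prod.smul_fst, Prod.smul_snd, LieN21.smul_apply, RingHom.id_apply]; module
      map_lie' := fun {x y} => by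
        change ⁅x.1, y.1⁆ 0 • e₁ + ⁅x.1, y.1⁆ 1 • e₂ + ⁅x.2, y.2⁆ 0 • f₁ + ⁅x.2, y.2⁆ 1 • f₂ = _
        simp only [LieN21.lie_apply_zero, LieN21.lie_apply_one, add_lie, lie_add, smul_lie,
          lie_smul, lie_self, h12, h13, h41, h23, h42, h43, h21, h31, h14, h32, h24, h34]
        module }
  refine nonempty_lieEquiv_of_lieHom_injective (by rw [hL, Module.finrank_prod, hN]) f fun m hm => ?_
  replace hm : m.1 0 • e₁ + m.1 1 • e₂ + m.2 0 • f₁ + m.2 1 • f₂ = 0 := hm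
  have k1 := congrArg (⁅·, e₁⁆) hm
  have k2 := congrArg (⁅·, e₂⁆) hm
  have k3 := congrArg (⁅·, f₁⁆) hm
  have m1 : m.1 1 = 0 := by simpa [h21, h31, h41, he] using k1
  have m0 : m.1 0 = 0 := by simpa [h12, h32, h42, he] using k2
  have m3 : m.2 1 = 0 := by simpa [h13, h23, h43, hf] using k3
  exact Prod.ext (LieN21.eq_zero_iff.2 ⟨m0, m1⟩)
    (LieN21.eq_zero_iff.2 ⟨by simpa [m0, m1, m3, hf] using hm, m3⟩)

theorem nonempty_lieEquiv_of_heisenberg (hL : Module.finrank K L = 4) {x p q w : L}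
    (hpq : ⁅p, q⁆ = x) (hxp : ⁅x, p⁆ = 0) (hxq : ⁅x, q⁆ = 0) (hwq : ⁅w, q⁆ = 0)
    (hwx : ⁅w, x⁆ ≠ 0) : Nonempty (L ≃ₗ⁅K⁆ LieS411 K) := by
  have hx : x ≠ 0 := fun hx => hwx (by rw [hx, lie_zero])
  have hind (a b c d : K) : a • w + b • x + c • p + d • q = 0 → _ :=
    linearIndependent_of_commuting_triple hxp hxq (hpq ▸ hx) hwx
  obtain ⟨δ, i, j, k, hu⟩ := exists_coeffs_of_finrank_eq_four hL hind ⁅w, x⁆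
  obtain ⟨a, m, n, r, hwp⟩ := exists_coeffs_of_finrank_eq_four hL hind ⁅w, p⁆
  have hqp : ⁅q, p⁆ = -x := by rw [← lie_skew, hpq]
  have hqx : ⁅q, x⁆ = 0 := by rw [← lie_skew, hxq, neg_zero]
  have hxw : ⁅x, w⁆ = -⁅w, x⁆ := by rw [lie_skew]
  have J1 := leibniz_lie w p q
  simp only [hpq, hwp, hwq, add_lie, smul_lie, hxq, lie_self, lie_zero] at J1
  have J2 := leibniz_lie w x p
  simp only [hwp, hxp, lie_zero, lie_add, lie_smul, lie_self, hxq, hxw] at J2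
  have hux : ⁅w, x⁆ = n • x := by rw [J1]; module
  rw [hux] at J2 hxw hwx
  have hn : n ≠ 0 := fun h => hwx (by rw [h, zero_smul])
  have ha : a = 0 := by
    rw [smul_lie, hxp] at J2
    simpa [hn, hx] using J2
  subst ha
  -- Now `[w, x] = n x` and `[w, p] = m x + n p + r q`. Adding `m q` to `w` removes the `x` term,
  -- and `p + (r / n) q` is then an eigenvector.
  refine nonempty_lieEquiv_lieS411 hL (e₁ := x) (e₂ := p + (r / n) • q) (e₃ := q)
    (e₄ := n⁻¹ • (w + m • q)) hx ?_ ?_ ?_ ?_ ?_ ?_ <;>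
  simp only [add_lie, lie_add, smul_lie, lie_smul, lie_self, hxp, hxq, hpq, hqp, hwq, hux, hwp,
    hqx, smul_zero, add_zero]
  · rw [smul_smul, inv_mul_cancel₀ hn, one_smul]
  · match_scalars <;> field_simp <;> ring

/-- The Jacobi identities for `w` with pairs from `x, h, v` become equations in the structure
constants. The case split is on the `w`-coefficients `δ` of `[w, x]` and `a` of `[w, h]`. -/
theorem nonempty_lieEquiv_of_affine (hL : Module.finrank K L = 4) (h2 : (2 : K) ≠ 0)
    {x h v w : L} (hv : v ≠ 0) (hhv : ⁅h, v⁆ = v) (hxh : ⁅x, h⁆ = 0) (hxv : ⁅x, v⁆ = 0)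
    (hwx : ⁅w, x⁆ ≠ 0) :
    Nonempty (L ≃ₗ⁅K⁆ LieN21 K × LieN21 K) ∨ Nonempty (L ≃ₗ⁅K⁆ LieS411 K) := by
  have hind (a b c d : K) : a • w + b • x + c • h + d • v = 0 → _ :=
    linearIndependent_of_commuting_triple hxh hxv (hhv.symm ▸ hv) hwx
  obtain ⟨δ, i, j, k, hu⟩ := exists_coeffs_of_finrank_eq_four hL hind ⁅w, x⁆
  obtain ⟨a, m, n, r, hwh⟩ := exists_coeffs_of_finrank_eq_four hL hind ⁅w, h⁆
  obtain ⟨b, m', n', r', hwv⟩ := exists_coeffs_of_finrank_eq_four hL hind ⁅w, v⁆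
  have hvh : ⁅v, h⁆ = -v := by rw [← lie_skew, hhv]
  have hhx : ⁅h, x⁆ = 0 := by rw [← lie_skew, hxh, neg_zero]
  have hvx : ⁅v, x⁆ = 0 := by rw [← lie_skew, hxv, neg_zero]
  have hxw : ⁅x, w⁆ = -(δ • w + i • x + j • h + k • v) := by rw [← hu, lie_skew]
  have hhw : ⁅h, w⁆ = -(a • w + m • x + n • h + r • v) := by rw [← hwh, lie_skew]
  have hvw : ⁅v, w⁆ = -(b • w + m' • x + n' • h + r' • v) := by rw [← hwv, lie_skew]
  have J1 := leibniz_lie w x h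
  have J2 := leibniz_lie w x v
  have J3 := leibniz_lie w h v
  simp only [hu, hwh, hwv, hxw, hhw, hxh, hxv, hhv, hvh, hhx, add_lie, smul_lie,
    lie_self, lie_add, lie_smul, lie_zero] at J1 J2 J3
  obtain ⟨-, A1, A2, A3⟩ := hind 0 (δ * m - a * i) (δ * n - a * j) (δ * r - k - a * k) (by
    linear_combination (norm := module) (-1 : K) • J1)
  obtain ⟨-, B1, B2, B3⟩ := hind 0 (δ * m' - b * i) (δ * n' - b * j) (δ * r' + j - b * k) (by
    linear_combination (norm := module) (-1 : K) • J2)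
  obtain ⟨C0, C1, C2, C3⟩ := hind b (m' - a * m' + b * m) (n' - a * n' + b * n)
    (r' - a * r' - n - r' + b * r) (by linear_combination (norm := module) (1 : K) • J3)
  subst C0
  have hj : j = -δ * r' := by linear_combination B3
  by_cases hδ : δ = 0
  · subst hδ
    have hj : j = 0 := by simpa using hj
    subst hj
    by_cases ha : a = 0
    · subst ha
      have hk : k = 0 := by linear_combination -A3
      have hm' : m' = 0 := by linear_combination C1
      have hn' : n' = 0 := by linear_combination C2
      have hn : n = 0 := by linear_combination -C3
      subst hk hm' hn' hn
      have hi : i ≠ 0 := fun hi => hwx (by rw [hu, hi]; module)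
      left
      -- Here `f₂` is `-h` corrected so that `[w, f₂]` has no `x` term; then `w + r' f₂ + r v`
      -- commutes with `v` and `f₂`.
      refine nonempty_lieEquiv_lieN21_prod hL (e₁ := x)
        (e₂ := -i⁻¹ • (w - r' • (h - (m / i) • x) + r • v)) (f₁ := v) (f₂ := (m / i) • x - h)
        (fun hx => hwx (by rw [hx, lie_zero])) hv ?_ ?_ ?_ ?_ ?_ ?_ <;>
      simp only [add_lie, lie_add, sub_lie, lie_sub, smul_lie, lie_smul, lie_self, hu, hwh, hwv,
        hxw, hxh, hxv, hhv, hvh, hhx, hvx] <;> match_scalars <;> field_simp <;> ring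
    · have hi : i = 0 := by
        have : a * i = 0 := by linear_combination -A1
        simpa [ha] using this
      have hk : k ≠ 0 := fun hk => hwx (by rw [hu, hi, hk]; module)
      have ha : a = -1 := by
        have : k * (a + 1) = 0 := by linear_combination -A3
        exact eq_neg_of_add_eq_zero_left ((mul_eq_zero.1 this).resolve_left hk)
      have hm' : m' = 0 := by
        have : 2 * m' = 0 := by linear_combination C1 + m' * ha
        simpa [h2] using this
      have hn' : n' = 0 := by
        have : 2 * n' = 0 := by linear_combination C2 + n' * ha
        simpa [h2] using this
      have hn : n = r' := by linear_combination -C3 - r' * ha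
      subst hi ha hm' hn' hn
      right
      -- `e₂` is `[h, w]`; the `x` term in `e₄` cancels the `v` term of `[h, e₂]`.
      refine nonempty_lieEquiv_lieS411 hL (e₁ := v) (e₂ := w - m • x - n • h - r • v)
        (e₃ := k⁻¹ • x) (e₄ := h - (r / k) • x) hv ?_ ?_ ?_ ?_ ?_ ?_ <;>
      simp only [sub_lie, lie_sub, smul_lie, lie_smul, lie_self, hu, hxw, hhw, hvw, hxh, hxv,
        hhv, hvh, hhx, hvx] <;> match_scalars <;> field_simp <;> ring
  · have hm' : m' = 0 := by simpa [hδ] using B1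
    have hn' : n' = 0 := by simpa [hδ] using B2
    have hm : m = a * i / δ := by field_simp; linear_combination A1
    have hn : n = a * j / δ := by field_simp; linear_combination A2
    have hr : r = (k + a * k) / δ := by field_simp; linear_combination A3
    subst hm' hn' hm hn hr hj
    left
    -- `[w, x]` is an eigenvector of `ad x` with eigenvalue `-δ`; the `x` term in `f₂` makes `f₂`
    -- commute with it.
    refine nonempty_lieEquiv_lieN21_prod hL (e₁ := ⁅w, x⁆) (e₂ := δ⁻¹ • x) (f₁ := v)
      (f₂ := (a / δ) • x - h) hwx hv ?_ ?_ ?_ ?_ ?_ ?_ <;>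
    simp only [add_lie, lie_sub, smul_lie, lie_smul, lie_self, hu, hwh, hwv, hxh, hxv, hhv, hvh,
      hhx, hvx] <;> match_scalars <;> field_simp <;> ring

/-- A four-dimensional Lie algebra with connected commuting graph is isomorphic to `𝔫₂,₁ ⊕ 𝔫₂,₁`
or to `𝔰₄,₁₁`. -/
theorem nonempty_lieEquiv_of_connected_lieCommutingGraph (hL : Module.finrank K L = 4)
    (h2 : (2 : K) ≠ 0) (hG : (lieCommutingGraph K L).Connected) :
    Nonempty (L ≃ₗ⁅K⁆ LieN21 K × LieN21 K) ∨ Nonempty (L ≃ₗ⁅K⁆ LieS411 K) := by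
  obtain ⟨x, y, z, hx, hxy, hxz, hyz⟩ := exists_lie_ne_zero_of_connected hG
  obtain ⟨w, hwx⟩ : ∃ w, ⁅w, x⁆ ≠ 0 := by
    by_contra! hcon
    exact hx (LieAlgebra.mem_center_iff_forall_lie.2 fun w => by rw [← lie_skew, hcon, neg_zero])
  have hind (a b c d : K) : a • w + b • x + c • y + d • z = 0 → _ :=
    linearIndependent_of_commuting_triple hxy hxz hyz hwx
  have hzy : ⁅z, y⁆ = -⁅y, z⁆ := by rw [lie_skew]
  have hyx : ⁅y, x⁆ = 0 := by rw [← lie_skew, hxy, neg_zero]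
  have hzx : ⁅z, x⁆ = 0 := by rw [← lie_skew, hxz, neg_zero]
  obtain ⟨δ, α, β, γ, hv⟩ := exists_coeffs_of_finrank_eq_four hL hind ⁅y, z⁆
  have hxv : ⁅x, ⁅y, z⁆⁆ = 0 := by rw [leibniz_lie, hxy, hxz, zero_lie, lie_zero, add_zero]
  have hxw : ⁅x, w⁆ ≠ 0 := by rwa [← lie_skew, neg_ne_zero]
  have hδ : δ = 0 := by
    rw [hv] at hxv
    simpa [hxy, hxz, hxw] using hxv
  subst hδ
  rw [zero_smul, zero_add] at hv
  by_cases hγ : γ = 0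
  · by_cases hβ : β = 0
    · rw [hγ, hβ, zero_smul, add_zero, zero_smul, add_zero] at hv
      right
      have hα : α ≠ 0 := fun hα => hyz (by rw [hv, hα, zero_smul])
      obtain ⟨c, hwc, hc⟩ := exists_lie_eq_zero_notMem_span_of_connected hG
        (LieAlgebra.notMem_center_of_lie_ne_zero (K := K) hwx)
      obtain ⟨t, b, p, q, rfl⟩ := exists_coeffs_of_finrank_eq_four hL hind c
      -- Dropping the `w` component keeps an element commuting with `w`. It is nonzero and, since
      -- `[w, x] ≠ 0`, not in `Kx`, so it can replace `y` or `z` in the Heisenberg pair.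
      have hwc' : ⁅w, b • x + p • y + q • z⁆ = 0 := by
        simpa only [lie_add, lie_smul, lie_self, smul_zero, zero_add] using hwc
      by_cases hq : q = 0
      · by_cases hp : p = 0
        · have hb : b = 0 := by simpa [hp, hq, hwx] using hwc'
          exact absurd (by rw [hb, hp, hq]; module) (hc t)
        · refine nonempty_lieEquiv_of_heisenberg hL (p := z) (q := b • x + p • y + q • z)
            rfl ?_ ?_ hwc' ?_ <;> simp [hxy, hxz, hzx, hzy, hv, hp, hα, hwx]
      · refine nonempty_lieEquiv_of_heisenberg hL (p := y) (q := b • x + p • y + q • z)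
          rfl ?_ ?_ hwc' ?_ <;> simp [hxy, hxz, hyx, hv, hq, hα, hwx]
    · refine nonempty_lieEquiv_of_affine hL h2 (x := x) (h := -β⁻¹ • z) (v := ⁅y, z⁆) hyz ?_ ?_
        hxv hwx
      · nth_rewrite 1 [hv]
        simp [hzx, hzy, hβ, hγ, -lie_skew]
      · simp [hxz]
  · refine nonempty_lieEquiv_of_affine hL h2 (x := x) (h := γ⁻¹ • y) (v := ⁅y, z⁆) hyz ?_
      ?_ hxv hwx
    · nth_rewrite 1 [hv]
      simp [hyx, hγ]
    · simp [hxy]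

end Classification

theorem mainTheorem3 :
    (∀ (L : Type*) [LieRing L] [LieAlgebra ℝ L] [LieAlgebra.IsSolvable L],
      Module.finrank ℝ L = 4 → ¬ IsLieAbelian L →
        ((lieCommutingGraph ℝ L).Connected ↔
          Nonempty (L ≃ₗ⁅ℝ⁆ LieN21 ℝ × LieN21 ℝ) ∨ Nonempty (L ≃ₗ⁅ℝ⁆ LieS411 ℝ))) ∧
    (lieCommutingGraph ℝ (LieN21 ℝ × LieN21 ℝ)).ediam = 3 ∧
    (lieCommutingGraph ℝ (LieS411 ℝ)).ediam = 3 := by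
  refine ⟨fun L _ _ _ hL hab => ⟨nonempty_lieEquiv_of_connected_lieCommutingGraph hL two_ne_zero,
    fun h => ?_⟩, LieN21.ediam_lieCommutingGraph_prod, LieS411.ediam_lieCommutingGraph⟩
  obtain ⟨u, hu⟩ : ∃ u : L, u ∉ LieAlgebra.center ℝ L := by
    by_contra! hcon
    exact hab ⟨fun x y => LieAlgebra.mem_center_iff_forall_lie.1 (hcon x) y⟩
  rcases h with ⟨⟨e⟩⟩ | ⟨⟨e⟩⟩
  all_goals
    let φ := lieCommutingGraphIso e
    have := Nonempty.intro (φ ⟨u, hu⟩)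
    refine φ.connected_iff.2 (SimpleGraph.connected_of_ediam_ne_top ?_)
  · rw [LieN21.ediam_lieCommutingGraph_prod]
    decide
  · rw [LieS411.ediam_lieCommutingGraph]
    decide
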